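/- Let $n\ge 0$ be an integer and let $Q$ be an $n\times n$ matrix whose entries are rational functions of $z\in\mathbb{C}$ with complex coefficients, all bounded near $z=\infty$; put $Q(\infty)=\lim_{z\to\infty}Q(z)\in\mathbb{C}^{n\times n}$. Suppose that the first-order system $y'(z)=Q(z)y(z)$ has a meromorphic fundamental system of solutions, that is, $n$ vector-valued functions $y_1,\dots,y_n$, meromorphic on $\mathbb{C}$, which are solutions of the system on the complement $\Omega$ of the set of poles of $Q$ and are linearly independent over $\mathbb{C}$ as functions on $\Omega$. Let $\lambda_1,\dots,\lambda_n\in\mathbb{C}$ be the eigenvalues of $Q(\infty)$, repeated according to algebraic multiplicity and listed in any order. Then there is an $n\times n$ matrix $R$ of rational functions such that $$Y(z)=R(z)\exp\bigl(\operatorname{diag}(\lambda_1 z,\dots,\lambda_n z)\bigr)$$ is a fundamental matrix of $y'=Qy$, that is, the columns of $Y$ are solutions of the system on $\Omega$ and are linearly independent over $\mathbb{C}$ as functions on $\Omega$. -/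

import Mathlib

namespace Halphen

noncomputable section

open Filter Topology

/-- The value `r(z)` of a rational function in lowest terms (only meaningful away from its poles). -/
def ratEval (r : RatFunc ℂ) (z : ℂ) : ℂ := RatFunc.eval (RingHom.id ℂ) z r

/-- The value `A(z)` of a matrix of rational functions. -/
def matEval {m n : ℕ} (A : Matrix (Fin m) (Fin n) (RatFunc ℂ)) (z : ℂ) :
    Matrix (Fin m) (Fin n) ℂ :=
  Matrix.of fun i j => ratEval (A i j) z

/-- The points of `ℂ` at which no entry of `A` has a pole. -/
def regularSet {m n : ℕ} (A : Matrix (Fin m) (Fin n) (RatFunc ℂ)) : Set ℂ :=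
  {z | ∀ i j, (A i j).denom.eval z ≠ 0}

/-- All entries of `A` are bounded near `∞`. -/
def BoundedAtInfinity {m n : ℕ} (A : Matrix (Fin m) (Fin n) (RatFunc ℂ)) : Prop :=
  ∀ i j, (fun z => ratEval (A i j) z) =O[Bornology.cobounded ℂ] (fun _ => (1 : ℂ))

/-- `A(∞)`: the entrywise limit of `A(z)` as `|z| → ∞`. The limit exists when `A` is bounded at
infinity. -/
def valueAtInfinity {m n : ℕ} (A : Matrix (Fin m) (Fin n) (RatFunc ℂ)) :
    Matrix (Fin m) (Fin n) ℂ :=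
  Matrix.of fun i j => limUnder (Bornology.cobounded ℂ) fun z => ratEval (A i j) z

/-- `y` is a (single-valued) solution of `y' = Q y` on the complement of the poles of `Q`. -/
def IsSolution {n : ℕ} (Q : Matrix (Fin n) (Fin n) (RatFunc ℂ)) (y : ℂ → Fin n → ℂ) : Prop :=
  ∀ z ∈ regularSet Q, HasDerivAt y (Matrix.mulVec (matEval Q z) (y z)) z

/-- `y 0, …, y (n-1)` is a fundamental system of solutions of `y' = Q y`: `n` solutions that are
linearly independent over `ℂ` as functions on the complement of the poles of `Q`. (The values that
the `y j` take as total functions at the poles of `Q` play no role.) -/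
def IsFundamentalSystem {n : ℕ} (Q : Matrix (Fin n) (Fin n) (RatFunc ℂ))
    (y : Fin n → ℂ → Fin n → ℂ) : Prop :=
  (∀ j, IsSolution Q (y j)) ∧ LinearIndependent ℂ fun j (z : regularSet Q) => y j z

/-- `Y` is a fundamental matrix of `y' = Q y`: its columns form a fundamental system. -/
def IsFundamentalMatrix {n : ℕ} (Q : Matrix (Fin n) (Fin n) (RatFunc ℂ))
    (Y : ℂ → Matrix (Fin n) (Fin n) ℂ) : Prop :=
  IsFundamentalSystem Q fun j z i => Y z i j

/-- `y' = Q y` has a fundamental system of solutions that are meromorphic on all of `ℂ`. -/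
def HasMeromorphicFundamentalSystem {n : ℕ} (Q : Matrix (Fin n) (Fin n) (RatFunc ℂ)) : Prop :=
  ∃ y : Fin n → ℂ → Fin n → ℂ, IsFundamentalSystem Q y ∧ ∀ j, Meromorphic (y j)

/-- `ev 0, …, ev (n-1)` are the eigenvalues of `A`, listed in some order with algebraic
multiplicity. -/
def IsEigenvalueList {n : ℕ} (A : Matrix (Fin n) (Fin n) ℂ) (ev : Fin n → ℂ) : Prop :=
  A.charpoly.roots = Multiset.map ev Finset.univ.val

end

end Halphen

namespace Halphen

open Filter Topology Polynomial

/-! Write `Q = A / p` with polynomial entries and `p` vanishing exactly at the poles of `Q`.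
Boundedness at infinity says `deg A i j ≤ deg p`. Let `Y` be the meromorphic fundamental matrix. Its
determinant has no zero off the roots of `p`, so for large `N` both `p ^ N * Y` and `p ^ N * Y⁻¹`
are entire.

Consider the entire row vectors `f = p⁻ᴺ wᵀ Y` with `w` a polynomial vector of degree at most `K`;
they form a finite-dimensional space. Then `p f' = p⁻ᴺ Wᵀ Y` with `W` polynomial of degree at most
`deg p + K`. Inverting, `Wᵀ = p f' (p ^ N Y⁻¹)`, whose last two factors are entire, so `p ∣ W` and
`W / p` has degree at most `K` again. The space is thus stable under differentiation
(`derivEnd_mem_rowSpace`), and Jordan theory for `d/dz` makes its members exponential polynomials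
(`exists_sum_expPoly`). With `w = p ^ (2N) eᵢ` this covers the entries of `p ^ N * Y`.

Exponentials with distinct exponents are independent over the polynomials, so each exponential part
of a column is itself a solution (`isPolySolution_expPoly`). These parts span the columns of `Y`;
`n` independent ones form a fundamental matrix `R exp(diag(μ z))` with `R` rational.

Finally the `μ j` are the eigenvalues of `Q(∞)`. In `w = 1/z` the leading Laurent coefficient at `0`
of a column of `R` is an eigenvector of `Q(∞)`; splitting it off by a Schur complement and inducting
on `n` gives the whole characteristic polynomial (`charpoly_eq_prod_of_meromorphicAt`). A
permutation of columns then realises any listing of the eigenvalues. -/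

/-! ### Rational functions as polynomial quotients, and their growth at infinity. -/

theorem ratEval_def (r : RatFunc ℂ) (z : ℂ) :
    ratEval r z = r.num.eval z / r.denom.eval z := by
  simp [ratEval, RatFunc.eval, Polynomial.eval₂_eq_eval_map]

/-- Evaluation uses lowest terms, and the reduced denominator divides `b`, so cancellation is
harmless wherever `b` does not vanish. -/
theorem ratEval_div (a b : ℂ[X]) {z : ℂ} (hb : b.eval z ≠ 0) :
    ratEval (algebraMap ℂ[X] (RatFunc ℂ) a / algebraMap ℂ[X] (RatFunc ℂ) b) z
      = a.eval z / b.eval z := by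
  have hb0 : b ≠ 0 := by rintro rfl; simp at hb
  set r := algebraMap ℂ[X] (RatFunc ℂ) a / algebraMap ℂ[X] (RatFunc ℂ) b with hr
  have hd : r.denom.eval z ≠ 0 := by
    obtain ⟨c, hc⟩ := RatFunc.denom_div_dvd a b
    intro h
    apply hb
    rw [hc, eval_mul, h, zero_mul]
  have h : r.num * b = a * r.denom := (RatFunc.num_mul_eq_mul_denom_iff hb0).2 hr
  rw [ratEval_def, div_eq_div_iff hd hb, ← eval_mul, ← eval_mul, h]

theorem exists_common_denominator {n : ℕ} (Q : Matrix (Fin n) (Fin n) (RatFunc ℂ)) :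
    ∃ (p : ℂ[X]) (A : Matrix (Fin n) (Fin n) ℂ[X]),
      p ≠ 0 ∧ (∀ z, z ∈ regularSet Q ↔ p.eval z ≠ 0) ∧
      ∀ z ∈ regularSet Q, ∀ i j, matEval Q z i j = (A i j).eval z / p.eval z := by
  -- The product of the reduced denominators vanishes only at poles of `Q`; an arbitrary common
  -- denominator could have extra zeros.
  obtain ⟨p, hp⟩ : ∃ p : ℂ[X], p = ∏ i : Fin n, ∏ j : Fin n, (Q i j).denom := ⟨_, rfl⟩
  have hd : ∀ i j, ∃ c, p = (Q i j).denom * c := fun i j => by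
    rw [hp]
    exact (Finset.dvd_prod_of_mem (fun j => (Q i j).denom) (Finset.mem_univ j)).trans
      (Finset.dvd_prod_of_mem (fun i => ∏ j : Fin n, (Q i j).denom) (Finset.mem_univ i))
  choose c hc using hd
  have hreg : ∀ z, z ∈ regularSet Q ↔ p.eval z ≠ 0 := by
    intro z
    simp [regularSet, hp, eval_prod, Finset.prod_eq_zero_iff]
  refine ⟨p, fun i j => (Q i j).num * c i j, ?_, hreg, ?_⟩
  · rw [hp]
    exact Finset.prod_ne_zero_iff.2 fun i _ => Finset.prod_ne_zero_iff.2 fun j _ =>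
      RatFunc.denom_ne_zero _
  · intro z hz i j
    have h1 : (Q i j).denom.eval z ≠ 0 := hz i j
    have h2 := (hreg z).1 hz
    rw [hc i j, eval_mul] at h2 ⊢
    rw [matEval, Matrix.of_apply, ratEval_def, eval_mul, mul_div_mul_right _ _ (right_ne_zero_of_mul h2)]

theorem tendsto_eval_div_pow_natDegree (a : ℂ[X]) :
    Tendsto (fun z => a.eval z / z ^ a.natDegree) (Bornology.cobounded ℂ) (𝓝 a.leadingCoeff) := by
  have h : Tendsto (fun z : ℂ => a.reverse.eval z⁻¹) (Bornology.cobounded ℂ)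
      (𝓝 (a.reverse.eval 0)) :=
    (a.reverse.continuous.tendsto 0).comp tendsto_inv₀_cobounded
  rw [← coeff_zero_eq_eval_zero, coeff_zero_reverse] at h
  refine h.congr' ?_
  filter_upwards [Bornology.eventually_ne_cobounded (0 : ℂ)] with z hz
  let := invertibleOfNonzero hz
  have h2 := eval₂_reverse_mul_pow (RingHom.id ℂ) z a
  simp only [invOf_eq_inv, eval₂_id] at h2
  rw [eq_div_iff (pow_ne_zero _ hz), h2]

theorem eventually_eval_ne_zero {q : ℂ[X]} (hq : q ≠ 0) :
    ∀ᶠ z in Bornology.cobounded ℂ, q.eval z ≠ 0 := by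
  filter_upwards [(tendsto_eval_div_pow_natDegree q).eventually_ne
    (leadingCoeff_ne_zero.2 hq)] with z hz h0
  simp [h0] at hz

theorem natDegree_le_of_isBigO {a p : ℂ[X]} (hp : p ≠ 0)
    (h : (fun z => a.eval z / p.eval z) =O[Bornology.cobounded ℂ] (fun _ => (1 : ℂ))) :
    a.natDegree ≤ p.natDegree := by
  by_contra! hlt
  have ha : a ≠ 0 := by rintro rfl; simp at hlt
  have h1 := (tendsto_eval_div_pow_natDegree p).div (tendsto_eval_div_pow_natDegree a)
    (leadingCoeff_ne_zero.2 ha)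
  have h2 : Tendsto (fun z : ℂ => (z⁻¹) ^ (a.natDegree - p.natDegree)) (Bornology.cobounded ℂ)
      (𝓝 0) := by
    have := (tendsto_inv₀_cobounded (α := ℂ)).pow (a.natDegree - p.natDegree)
    rwa [zero_pow (by omega)] at this
  -- The product is eventually identically `1`, yet it is a bounded factor times one tending to `0`.
  have h3 : Tendsto (fun z => a.eval z / p.eval z *
      ((p.eval z / z ^ p.natDegree) / (a.eval z / z ^ a.natDegree) *
        (z⁻¹) ^ (a.natDegree - p.natDegree))) (Bornology.cobounded ℂ) (𝓝 0) := by
    have h4 := h1.mul h2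
    rw [mul_zero] at h4
    have h5 := h.mul_isLittleO ((Asymptotics.isLittleO_one_iff ℂ).2 h4)
    simpa using h5
  have h6 : Tendsto (fun _ : ℂ => (1 : ℂ)) (Bornology.cobounded ℂ) (𝓝 0) := by
    refine h3.congr' ?_
    filter_upwards [eventually_eval_ne_zero ha, eventually_eval_ne_zero hp,
       Bornology.eventually_ne_cobounded (0 : ℂ)] with z h1 h2 h3
    obtain ⟨k, hk⟩ := Nat.exists_eq_add_of_lt hlt
    have : a.natDegree - p.natDegree = k + 1 := by omega
    rw [this, hk, inv_pow, add_assoc, pow_add]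
    field_simp
  simpa using tendsto_nhds_unique h6 tendsto_const_nhds

theorem tendsto_eval_div {a p : ℂ[X]} (hp : p ≠ 0) (h : a.natDegree ≤ p.natDegree) :
    ∃ c, Tendsto (fun z => a.eval z / p.eval z) (Bornology.cobounded ℂ) (𝓝 c) := by
  have h1 := (tendsto_eval_div_pow_natDegree a).div (tendsto_eval_div_pow_natDegree p)
    (leadingCoeff_ne_zero.2 hp)
  have h2 := (tendsto_inv₀_cobounded (α := ℂ)).pow (p.natDegree - a.natDegree)
  refine ⟨_, (h1.mul h2).congr' ?_⟩
  filter_upwards [Bornology.eventually_ne_cobounded (0 : ℂ)] with z h3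
  obtain ⟨k, hk⟩ := Nat.exists_eq_add_of_le h
  have : p.natDegree - a.natDegree = k := by omega
  simp only [Pi.div_apply]
  rw [this, hk, pow_add, inv_pow]
  field_simp

/-- If a polynomial is divisible by `p` as a continuous function, then so it is as a polynomial. -/
theorem dvd_of_eval_eq_mul_continuous (p : ℂ[X]) (hp : p ≠ 0) (W : ℂ[X]) (g : ℂ → ℂ)
    (hg : Continuous g) (h : ∀ z, W.eval z = p.eval z * g z) : p ∣ W := by
  induction hd : p.natDegree generalizing p W with
  | zero =>
    obtain ⟨c, rfl⟩ := natDegree_eq_zero.1 hd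
    have hc : c ≠ 0 := by rintro rfl; simp at hp
    exact (isUnit_C.2 hc.isUnit).dvd
  | succ d ih =>
    obtain ⟨a, ha⟩ := IsAlgClosed.exists_root p (by
      rw [degree_eq_natDegree hp, hd]; exact_mod_cast d.succ_ne_zero)
    obtain ⟨p₁, rfl⟩ := dvd_iff_isRoot.2 ha
    have hWa : IsRoot W a := by rw [IsRoot, h, ha.eq_zero, zero_mul]
    obtain ⟨W₁, rfl⟩ := dvd_iff_isRoot.2 hWa
    refine mul_dvd_mul_left _ (ih p₁ (right_ne_zero_of_mul hp) W₁ ?_ ?_)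
    -- Cancelling the common root is legitimate off `a`; continuity of `g` restores the identity at
    -- `a`.
    · have heq : ∀ z ∈ ({a}ᶜ : Set ℂ), W₁.eval z = p₁.eval z * g z := by
        intro z hz
        have h1 := h z
        have : z - a ≠ 0 := sub_ne_zero.2 hz
        simp only [eval_mul, eval_sub, eval_X, eval_C] at h1
        exact mul_left_cancel₀ this (by rw [h1, mul_assoc])
      exact congrFun (Continuous.ext_on (dense_compl_singleton a) W₁.continuous
        (p₁.continuous.mul hg) heq)
    · rw [natDegree_mul (X_sub_C_ne_zero a) (right_ne_zero_of_mul hp), natDegree_X_sub_C] at hd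
      omega

/-! ### Local analysis at `w = 1/z = 0`: exponents as eigenvalues. -/

theorem meromorphicAt_pi {n : ℕ} {f : ℂ → Fin n → ℂ} {x : ℂ}
    (hf : ∀ i, MeromorphicAt (fun z => f z i) x) : MeromorphicAt f x := by
  have h : f = fun z => ∑ i, f z i • (Pi.single i 1 : Fin n → ℂ) := by
    funext z
    ext j
    simp [Finset.sum_apply, Pi.single_apply]
  rw [h]
  exact MeromorphicAt.fun_sum fun i _ => (hf i).fun_smul (MeromorphicAt.const _ x)

theorem meromorphicAt_apply {n : ℕ} {f : ℂ → Fin n → ℂ} {x : ℂ} (hf : MeromorphicAt f x)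
    (i : Fin n) : MeromorphicAt (fun z => f z i) x := by
  obtain ⟨k, hk⟩ := hf
  exact ⟨k, (ContinuousLinearMap.proj (R := ℂ) (φ := fun _ : Fin n => ℂ) i).analyticAt _ |>.comp hk⟩

theorem exists_isUnit_mulVec_eq {n : ℕ} {v u : Fin n → ℂ} (hv : v ≠ 0) (hu : u ≠ 0) :
    ∃ S : Matrix (Fin n) (Fin n) ℂ, IsUnit S.det ∧ S.mulVec v = u := by
  obtain ⟨e, he⟩ := SeparatingDual.exists_continuousLinearEquiv_apply_eq (R := ℂ) hv hu
  refine ⟨LinearMap.toMatrix' (e.toLinearEquiv : (Fin n → ℂ) →ₗ[ℂ] (Fin n → ℂ)), ?_, ?_⟩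
  · rw [LinearMap.det_toMatrix']
    exact LinearEquiv.isUnit_det' _
  · rw [LinearMap.toMatrix'_mulVec]
    exact he

theorem charpoly_of_col_zero {n : ℕ} (B : Matrix (Fin (n + 1)) (Fin (n + 1)) ℂ) (c : ℂ)
    (h0 : B 0 0 = c) (h : ∀ i : Fin n, B i.succ 0 = 0) :
    B.charpoly = (X - C c) * (B.submatrix Fin.succ Fin.succ).charpoly := by
  rw [Matrix.charpoly, Matrix.det_succ_column_zero, Fin.sum_univ_succ, Finset.sum_eq_zero]
  · have : B.charmatrix.submatrix (Fin.succAbove 0) Fin.succ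
        = (B.submatrix Fin.succ Fin.succ).charmatrix := by
      ext1 i j
      by_cases hij : i = j
      · subst hij; simp [Matrix.charmatrix_apply_eq]
      · rw [Matrix.charmatrix_apply_ne _ _ _ hij, Matrix.submatrix_apply, Fin.succAbove_zero,
          Matrix.charmatrix_apply_ne _ _ _ (fun h => hij (Fin.succ_injective _ h))]
        rfl
    rw [this, Matrix.charmatrix_apply_eq, h0, Matrix.charpoly]
    simp
  · intro i _
    rw [Matrix.charmatrix_apply_ne _ _ _ (Fin.succ_ne_zero i), h]
    simp

theorem det_eq_mul_det_schur {n : ℕ} (B : Matrix (Fin (n + 1)) (Fin (n + 1)) ℂ) (h : B 0 0 ≠ 0) :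
    B.det = B 0 0 * (Matrix.of fun i j : Fin n =>
      B i.succ j.succ - B i.succ 0 / B 0 0 * B 0 j.succ).det := by
  have h1 := Matrix.det_eq_of_forall_row_eq_smul_add_const
    (A := B) (B := Matrix.of fun i j => B i j - (Fin.cases 0 (fun i => B i.succ 0 / B 0 0) i) * B 0 j)
    (Fin.cases 0 (fun i => B i.succ 0 / B 0 0)) 0 rfl (by intro i j; simp)
  rw [h1, Matrix.det_succ_column_zero, Fin.sum_univ_succ, Finset.sum_eq_zero]
  · simp only [Fin.val_zero, pow_zero, one_mul, add_zero, Matrix.of_apply, Fin.cases_zero, zero_mul,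
      sub_zero]
    congr 2
  · intro i _
    simp [h]

/-- The leading behaviour at `0` of a meromorphic vector `r` with `-w² r' + c r = Q r`. -/
theorem exists_eigenvector_of_meromorphicAt {n : ℕ} {r : ℂ → Fin n → ℂ}
    (hr : ∀ i, MeromorphicAt (fun w => r w i) 0) {Q : ℂ → Matrix (Fin n) (Fin n) ℂ}
    {Q₀ : Matrix (Fin n) (Fin n) ℂ} (hQ : ∀ i j, Tendsto (fun w => Q w i j) (𝓝[≠] 0) (𝓝 (Q₀ i j)))
    {c : ℂ} (hODE : ∀ᶠ w in 𝓝[≠] (0 : ℂ), ∀ i,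
      HasDerivAt (fun w => r w i) ((c * r w i - (Q w).mulVec (r w) i) / w ^ 2) w)
    (hne : ∃ᶠ w in 𝓝[≠] (0 : ℂ), r w ≠ 0) :
    ∃ (k : ℤ) (g : ℂ → Fin n → ℂ), ContinuousAt g 0 ∧ g 0 ≠ 0 ∧
      (∀ᶠ w in 𝓝[≠] 0, r w = w ^ k • g w) ∧ Q₀.mulVec (g 0) = c • g 0 := by
  have hmer : MeromorphicAt r 0 := meromorphicAt_pi hr
  have htop : meromorphicOrderAt r 0 ≠ ⊤ := by
    rw [Ne, meromorphicOrderAt_eq_top_iff]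
    exact fun h => hne (h.mono fun w hw => not_not.2 hw)
  obtain ⟨g, hg, hg0, heq⟩ := (meromorphicOrderAt_ne_top_iff hmer).1 htop
  set k := (meromorphicOrderAt r 0).untop₀
  simp only [sub_zero] at heq
  refine ⟨k, g, hg.continuousAt, hg0, heq, ?_⟩
  have hgi : ∀ i, AnalyticAt ℂ (fun w => g w i) 0 := fun i =>
    (ContinuousLinearMap.proj (R := ℂ) (φ := fun _ : Fin n => ℂ) i).analyticAt _ |>.comp hg
  have hle : 𝓝[≠] (0 : ℂ) ≤ 𝓝 0 := nhdsWithin_le_nhds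
  ext i
  -- Insert `r = w ^ k • g` into the equation and cancel `w ^ k`. The derivative terms carry a
  -- factor `w`, so only `c g = Q g` survives as `w → 0`.
  have hkey : ∀ᶠ w in 𝓝[≠] (0 : ℂ), w * k * g w i + w ^ 2 * deriv (fun w => g w i) w
      = c * g w i - (Q w).mulVec (g w) i := by
    filter_upwards [hODE, eventually_eventually_nhdsWithin.2 heq, heq, self_mem_nhdsWithin,
      hle (hgi i).eventually_analyticAt] with w h1 h2 h3 hw0 h4
    have hw0 : w ≠ 0 := hw0
    have h5 := ((hasDerivAt_zpow k w (Or.inl hw0)).mul h4.differentiableAt.hasDerivAt)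
    have h2' : ∀ᶠ x in 𝓝 w, r x = x ^ k • g x := by
      rwa [nhdsWithin_eq_nhds.2 (isOpen_compl_singleton.mem_nhds hw0)] at h2
    have h6 := (h1 i).congr_of_eventuallyEq (f₁ := (fun x => x ^ k) * fun x => g x i)
      (h2'.mono fun x hx => by simp [hx])
    have h7 := h5.unique h6
    rw [h3] at h7
    rw [Matrix.mulVec_smul] at h7
    simp only [Pi.smul_apply, smul_eq_mul] at h7
    rw [zpow_sub_one₀ hw0] at h7
    have hk : w ^ k ≠ 0 := zpow_ne_zero _ hw0
    field_simp at h7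
    linear_combination h7
  have hgc : Tendsto (fun w => g w i) (𝓝[≠] 0) (𝓝 (g 0 i)) :=
    (hgi i).continuousAt.tendsto.mono_left hle
  have hl : Tendsto (fun w : ℂ => w * k * g w i + w ^ 2 * deriv (fun w => g w i) w) (𝓝[≠] 0)
      (𝓝 (0 * k * g 0 i + 0 ^ 2 * deriv (fun w => g w i) 0)) := by
    have hid : Tendsto (fun w : ℂ => w) (𝓝[≠] 0) (𝓝 0) := hle
    exact ((hid.mul_const _).mul hgc).add ((hid.pow 2).mul
      ((hgi i).deriv.continuousAt.tendsto.mono_left hle))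
  have hr' : Tendsto (fun w => c * g w i - (Q w).mulVec (g w) i) (𝓝[≠] 0)
      (𝓝 (c * g 0 i - Q₀.mulVec (g 0) i)) := by
    refine (hgc.const_mul c).sub ?_
    simp only [Matrix.mulVec, dotProduct]
    exact tendsto_finsetSum _ fun j _ => (hQ i j).mul ((hgi j).continuousAt.tendsto.mono_left hle)
  have := tendsto_nhds_unique (hl.congr' hkey) hr'
  simp only [Pi.smul_apply, smul_eq_mul]
  linear_combination this

/-- The matrix product in the differential equation of the Schur complement, with the index `0`
removed from all sums. -/
theorem sum_schur {n : ℕ} (q q₀ r r₀ : Fin n → ℂ) (β c d : ℂ) :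
    ∑ k, (q k - β * q₀ k) * (r k - r₀ k / c * d) = ∑ k, q k * r k - β * ∑ k, q₀ k * r k
      - (∑ k, q k * r₀ k - β * ∑ k, q₀ k * r₀ k) * (d / c) := by
  simp only [Finset.mul_sum, Finset.sum_mul, ← Finset.sum_sub_distrib]
  exact Finset.sum_congr rfl fun k _ => by ring

/-- Deflation. After a constant change of basis the leading vector of column `0` is `e₀`, an
eigenvector of the limit matrix. Eliminating column `0` with the ratios `β i = R₁ w i.succ 0 / R₁ w
0 0` leaves a smaller system of the same kind with coefficients `Q₁ i j - β i * Q₁ 0 j`. Since `β →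
0`, its limit is the lower right block of the limit matrix. -/
theorem charpoly_eq_prod_of_meromorphicAt {n : ℕ} (R Q : ℂ → Matrix (Fin n) (Fin n) ℂ)
    (hR : ∀ i j, MeromorphicAt (fun w => R w i j) 0) (Q₀ : Matrix (Fin n) (Fin n) ℂ)
    (hQ : ∀ i j, Tendsto (fun w => Q w i j) (𝓝[≠] 0) (𝓝 (Q₀ i j))) (μ : Fin n → ℂ)
    (hODE : ∀ᶠ w in 𝓝[≠] (0 : ℂ), ∀ i j,
      HasDerivAt (fun w => R w i j) ((μ j * R w i j - (Q w * R w) i j) / w ^ 2) w)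
    (hdet : ∀ᶠ w in 𝓝[≠] (0 : ℂ), (R w).det ≠ 0) :
    Q₀.charpoly = ∏ j, (X - C (μ j)) := by
  induction n with
  | zero => simp [Matrix.charpoly, Matrix.det_isEmpty]
  | succ n ih =>
    have hne : ∃ᶠ w in 𝓝[≠] (0 : ℂ), (fun i => R w i 0) ≠ 0 := by
      refine Eventually.frequently ?_
      filter_upwards [hdet] with w hw h0
      exact hw (Matrix.det_eq_zero_of_column_eq_zero 0 fun i => congrFun h0 i)
    obtain ⟨k, g, hg, hg0, heq, heig⟩ := exists_eigenvector_of_meromorphicAt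
      (r := fun w i => R w i 0) (fun i => hR i 0) hQ (c := μ 0)
      (hODE.mono fun w hw i => hw i 0) hne
    obtain ⟨S, hS, hSg⟩ := exists_isUnit_mulVec_eq hg0
      (u := Pi.single 0 1) (by intro h; simpa using congrFun h 0)
    have hSi : S⁻¹ * S = 1 := Matrix.nonsing_inv_mul _ hS
    -- constant gauge transformation
    set R₁ : ℂ → Matrix (Fin (n + 1)) (Fin (n + 1)) ℂ := fun w => S * R w with hR₁
    set Q₁ : ℂ → Matrix (Fin (n + 1)) (Fin (n + 1)) ℂ := fun w => S * Q w * S⁻¹ with hQ₁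
    set B : Matrix (Fin (n + 1)) (Fin (n + 1)) ℂ := S * Q₀ * S⁻¹ with hB
    have hchar : B.charpoly = Q₀.charpoly := by
      rw [hB, Matrix.charpoly_mul_comm, ← Matrix.mul_assoc, hSi, Matrix.one_mul]
    have hQ₁t : ∀ i j, Tendsto (fun w => Q₁ w i j) (𝓝[≠] 0) (𝓝 (B i j)) := by
      intro i j
      simp only [hQ₁, hB, Matrix.mul_apply]
      exact tendsto_finsetSum _ fun a _ => (tendsto_finsetSum _ fun b _ =>
        (hQ b a).const_mul _).mul_const _
    have hR₁m : ∀ i j, MeromorphicAt (fun w => R₁ w i j) 0 := by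
      intro i j
      simp only [hR₁, Matrix.mul_apply]
      exact MeromorphicAt.fun_sum fun a _ => (MeromorphicAt.const _ _).fun_mul (hR a j)
    have hODE₁ : ∀ᶠ w in 𝓝[≠] (0 : ℂ), ∀ i j,
        HasDerivAt (fun w => R₁ w i j) ((μ j * R₁ w i j - (Q₁ w * R₁ w) i j) / w ^ 2) w := by
      filter_upwards [hODE] with w hw i j
      have h1 : Q₁ w * R₁ w = S * (Q w * R w) := by
        simp only [hQ₁, hR₁]
        rw [Matrix.mul_assoc, ← Matrix.mul_assoc S⁻¹, hSi, Matrix.one_mul, Matrix.mul_assoc]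
      rw [h1]
      simp only [hR₁, Matrix.mul_apply (M := S)]
      have h2 := HasDerivAt.fun_sum (u := Finset.univ) fun a _ => (hw a j).const_mul (S i a)
      refine h2.congr_deriv ?_
      rw [Finset.mul_sum, ← Finset.sum_sub_distrib, Finset.sum_div]
      exact Finset.sum_congr rfl fun a _ => by ring
    have hdet₁ : ∀ᶠ w in 𝓝[≠] (0 : ℂ), (R₁ w).det ≠ 0 := by
      filter_upwards [hdet] with w hw
      rw [hR₁, Matrix.det_mul]
      exact mul_ne_zero hS.ne_zero hw
    have hBcol : ∀ i, B i 0 = (Pi.single 0 (μ 0) : Fin (n + 1) → ℂ) i := by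
      have h1 : B.mulVec (Pi.single 0 1) = μ 0 • Pi.single 0 1 := by
        rw [← hSg, hB, Matrix.mulVec_mulVec, Matrix.mul_assoc, hSi, Matrix.mul_one,
          ← Matrix.mulVec_mulVec, heig, Matrix.mulVec_smul]
      intro i
      have h2 := congrFun h1 i
      rw [Matrix.mulVec_single_one] at h2
      simpa [Pi.single_apply] using h2
    have hcol₁ : ∀ᶠ w in 𝓝[≠] (0 : ℂ), ∀ i, R₁ w i 0 = w ^ k * S.mulVec (g w) i := by
      filter_upwards [heq] with w hw i
      have : R₁ w i 0 = S.mulVec (fun a => R w a 0) i := by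
        simp [hR₁, Matrix.mul_apply, Matrix.mulVec, dotProduct]
      rw [this, hw, Matrix.mulVec_smul]
      rfl
    have hSgt : ∀ i, Tendsto (fun w => S.mulVec (g w) i) (𝓝[≠] 0)
        (𝓝 ((Pi.single 0 1 : Fin (n + 1) → ℂ) i)) := by
      intro i
      rw [← hSg]
      simp only [Matrix.mulVec, dotProduct]
      exact tendsto_finsetSum _ fun a _ =>
        ((((continuous_apply a).continuousAt.comp hg).tendsto).mono_left
          nhdsWithin_le_nhds).const_mul _
    have h00 : ∀ᶠ w in 𝓝[≠] (0 : ℂ), R₁ w 0 0 ≠ 0 := by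
      have h1 := (hSgt 0).eventually_ne (by simp : (Pi.single 0 1 : Fin (n + 1) → ℂ) 0 ≠ 0)
      filter_upwards [hcol₁, h1, self_mem_nhdsWithin] with w h2 h3 h4
      rw [h2]
      exact mul_ne_zero (zpow_ne_zero _ h4) h3
    have hβ : ∀ i : Fin n, Tendsto (fun w => R₁ w i.succ 0 / R₁ w 0 0) (𝓝[≠] 0) (𝓝 0) := by
      intro i
      have h1 := (hSgt i.succ).div (hSgt 0) (by simp)
      simp only [Pi.single_apply, Fin.succ_ne_zero, if_false, zero_div] at h1
      refine h1.congr' ?_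
      filter_upwards [hcol₁, self_mem_nhdsWithin] with w h2 h4
      rw [h2, h2, Pi.div_apply, mul_div_mul_left _ _ (zpow_ne_zero _ h4)]
    -- Schur complement
    have hrec := ih
      (fun w => Matrix.of fun i j => R₁ w i.succ j.succ - R₁ w i.succ 0 / R₁ w 0 0 * R₁ w 0 j.succ)
      (fun w => Matrix.of fun i j => Q₁ w i.succ j.succ - R₁ w i.succ 0 / R₁ w 0 0 * Q₁ w 0 j.succ)
      (fun i j => (hR₁m _ _).sub (((hR₁m _ _).div (hR₁m _ _)).mul (hR₁m _ _)))
      (B.submatrix Fin.succ Fin.succ)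
      (fun i j => by
        have := (hQ₁t i.succ j.succ).sub ((hβ i).mul (hQ₁t 0 j.succ))
        simpa using this)
      (fun j => μ j.succ)
      (by
        filter_upwards [hODE₁, h00, self_mem_nhdsWithin] with w h1 h2 hw i j
        have hw : w ≠ 0 := hw
        have h3 := (h1 i.succ j.succ).sub
          (((h1 i.succ 0).div (h1 0 0) h2).mul (h1 0 j.succ))
        refine h3.congr_deriv ?_
        have hs := sum_schur (fun k : Fin n => Q₁ w i.succ k.succ) (fun k => Q₁ w 0 k.succ)
          (fun k => R₁ w k.succ j.succ) (fun k => R₁ w k.succ 0) (R₁ w i.succ 0 / R₁ w 0 0)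
          (R₁ w 0 0) (R₁ w 0 j.succ)
        simp only [Matrix.mul_apply, Fin.sum_univ_succ, Matrix.of_apply, hs, Pi.div_apply]
        field_simp
        ring)
      (by
        -- Elimination multiplies by a unipotent matrix, so the determinant factors through `R₁ w 0
        -- 0`.
        filter_upwards [hdet₁, h00] with w h1 h2 h3
        rw [det_eq_mul_det_schur _ h2] at h1
        exact (right_ne_zero_of_mul h1) h3)
    rw [← hchar, charpoly_of_col_zero B (μ 0) (by simp [hBcol]) (by simp [hBcol]), hrec,
      Fin.prod_univ_succ]

/-! ### Differentiation on entire functions and exponential polynomials. -/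

/-- The space of entire functions. -/
def entire : Submodule ℂ (ℂ → ℂ) where
  carrier := {f | Differentiable ℂ f}
  add_mem' := fun hf hg => Differentiable.add hf hg
  zero_mem' := differentiable_const 0
  smul_mem' := fun c _ hf => Differentiable.const_smul hf c

theorem entire_differentiable (f : entire) : Differentiable ℂ (f : ℂ → ℂ) := f.2

/-- Differentiation of entire functions. -/
noncomputable def derivEnd : Module.End ℂ entire where
  toFun f := ⟨deriv f, (entire_differentiable f).deriv⟩
  map_add' f g := Subtype.ext <| funext fun z =>
    deriv_add (entire_differentiable f z) (entire_differentiable g z)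
  map_smul' c f := Subtype.ext <| funext fun z => deriv_const_smul c (entire_differentiable f z)

theorem exists_derivative_eq (P : ℂ[X]) : ∃ P₁ : ℂ[X], derivative P₁ = P := by
  induction P using Polynomial.induction_on' with
  | add p q hp hq =>
    obtain ⟨p₁, rfl⟩ := hp
    obtain ⟨q₁, rfl⟩ := hq
    exact ⟨p₁ + q₁, derivative_add⟩
  | monomial k a =>
    refine ⟨monomial (k + 1) (a / (k + 1)), ?_⟩
    rw [derivative_monomial]
    have : (k : ℂ) + 1 ≠ 0 := by exact_mod_cast k.succ_ne_zero
    push_cast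
    rw [div_mul_cancel₀ _ this]

/-- The entire function `P(z) e^{μz}`. -/
noncomputable def expPoly (μ : ℂ) (P : ℂ[X]) : entire :=
  ⟨fun z => P.eval z * Complex.exp (μ * z), by
    change Differentiable ℂ _
    fun_prop⟩

theorem expPoly_apply (μ : ℂ) (P : ℂ[X]) (z : ℂ) :
    (expPoly μ P : ℂ → ℂ) z = P.eval z * Complex.exp (μ * z) := rfl

theorem hasDerivAt_expPoly (μ : ℂ) (P : ℂ[X]) (z : ℂ) :
    HasDerivAt (fun z => P.eval z * Complex.exp (μ * z))
      ((derivative P + C μ * P).eval z * Complex.exp (μ * z)) z := by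
  have h1 : HasDerivAt (fun z => Complex.exp (μ * z)) (Complex.exp (μ * z) * (μ * 1)) z :=
    ((hasDerivAt_id z).const_mul μ).cexp
  refine ((P.hasDerivAt z).mul h1).congr_deriv ?_
  simp only [eval_add, eval_mul, eval_C]
  ring

theorem derivEnd_sub_expPoly (μ : ℂ) (P : ℂ[X]) :
    (derivEnd - μ • 1) (expPoly μ P) = expPoly μ (derivative P) := by
  ext z
  change deriv (fun z => P.eval z * Complex.exp (μ * z)) z - μ * (P.eval z * Complex.exp (μ * z))
    = _
  rw [(hasDerivAt_expPoly μ P z).deriv, expPoly_apply, eval_add, eval_mul, eval_C]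
  ring

/-- Induction on `k`: if `f' - μ f = P₁' e^{μz}`, then `f e^{-μz} - P₁` has zero derivative and is
constant. -/
theorem exists_expPoly_of_pow_eq_zero {μ : ℂ} {k : ℕ} {f : entire}
    (h : ((derivEnd - μ • 1) ^ k) f = 0) : ∃ P, f = expPoly μ P := by
  induction k generalizing f with
  | zero =>
    refine ⟨0, ?_⟩
    ext z
    simpa [expPoly_apply] using congrFun (congrArg Subtype.val h) z
  | succ k ih =>
    rw [pow_succ, Module.End.mul_apply] at h
    obtain ⟨P, hP⟩ := ih h
    obtain ⟨P₁, rfl⟩ := exists_derivative_eq P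
    have h0 : ∀ z, deriv (f : ℂ → ℂ) z - μ * (f : ℂ → ℂ) z
        = (derivative P₁).eval z * Complex.exp (μ * z) := fun z =>
      congrFun (congrArg Subtype.val hP) z
    set g : ℂ → ℂ := fun z => (f : ℂ → ℂ) z * Complex.exp (-μ * z) - P₁.eval z with hg
    have hd : ∀ z, HasDerivAt g 0 z := by
      intro z
      have h1 : HasDerivAt (fun z => Complex.exp (-μ * z)) (Complex.exp (-μ * z) * (-μ * 1)) z :=
        ((hasDerivAt_id z).const_mul (-μ)).cexp
      refine (((entire_differentiable f z).hasDerivAt.mul h1).sub (P₁.hasDerivAt z)).congr_deriv ?_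
      have h2 : Complex.exp (μ * z) * Complex.exp (-μ * z) = 1 := by
        rw [← Complex.exp_add]; simp
      linear_combination Complex.exp (-μ * z) * h0 z + (derivative P₁).eval z * h2
    have hc : ∀ z, g z = g 0 := fun z =>
      is_const_of_deriv_eq_zero (fun z => (hd z).differentiableAt) (fun z => (hd z).deriv) z 0
    refine ⟨P₁ + C (g 0), ?_⟩
    ext z
    have h2 : Complex.exp (μ * z) * Complex.exp (-μ * z) = 1 := by
      rw [← Complex.exp_add]; simp
    have h3 := hc z
    rw [expPoly_apply, eval_add, eval_C, ← h3, hg]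
    linear_combination -(f : ℂ → ℂ) z * h2

theorem expPoly_mem_maxGenEigenspace (μ : ℂ) (P : ℂ[X]) :
    expPoly μ P ∈ derivEnd.maxGenEigenspace μ := by
  rw [Module.End.mem_maxGenEigenspace]
  have h : ∀ k, ((derivEnd - μ • 1) ^ k) (expPoly μ P) = expPoly μ (derivative^[k] P) := by
    intro k
    induction k with
    | zero => rfl
    | succ k ih =>
      rw [pow_succ', Module.End.mul_apply, ih, derivEnd_sub_expPoly, Function.iterate_succ_apply']
  refine ⟨P.natDegree + 1, ?_⟩
  rw [h, iterate_derivative_eq_zero (Nat.lt_succ_self _)]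
  ext z
  simp [expPoly_apply]

theorem expPoly_eq_zero {μ : ℂ} {P : ℂ[X]} (h : expPoly μ P = 0) : P = 0 := by
  refine Polynomial.funext fun z => ?_
  have h1 : P.eval z * Complex.exp (μ * z) = 0 := congrFun (congrArg Subtype.val h) z
  simpa [Complex.exp_ne_zero] using h1

/-- Exponentials with distinct exponents are linearly independent over the polynomials. -/
theorem eq_zero_of_sum_expPoly_eq_zero (S : Finset ℂ) (P : ℂ → ℂ[X])
    (h : ∀ z, ∑ μ ∈ S, (P μ).eval z * Complex.exp (μ * z) = 0) : ∀ μ ∈ S, P μ = 0 := by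
  have h1 : ∑ μ ∈ S, expPoly μ (P μ) = 0 := by
    ext z
    rw [AddSubmonoidClass.coe_finsetSum, Finset.sum_apply]
    exact h z
  intro μ hμ
  -- The summands lie in generalized eigenspaces of `d/dz` for distinct eigenvalues, which are
  -- independent.
  exact expPoly_eq_zero (iSupIndep_iff_finsetSum_eq_zero_imp_eq_zero _ |>.1
    derivEnd.independent_maxGenEigenspace S (fun μ => expPoly μ (P μ))
    (fun μ _ => expPoly_mem_maxGenEigenspace μ (P μ)) h1 μ hμ)

/-- A finite-dimensional space of entire functions which is stable under differentiation consists
of exponential polynomials. -/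
theorem exists_sum_expPoly (U : Submodule ℂ entire) [FiniteDimensional ℂ U]
    (hU : ∀ f ∈ U, derivEnd f ∈ U) (f : entire) (hf : f ∈ U) :
    ∃ (S : Finset ℂ) (P : ℂ → ℂ[X]), (∀ μ ∉ S, P μ = 0) ∧
      ∀ z, (f : ℂ → ℂ) z = ∑ μ ∈ S, (P μ).eval z * Complex.exp (μ * z) := by
  -- Over `ℂ`, a finite-dimensional space is spanned by the generalized eigenspaces of any
  -- endomorphism.
  have hmem : (⟨f, hf⟩ : U) ∈
      ⨆ μ, Module.End.maxGenEigenspace (LinearMap.restrict derivEnd hU) μ := by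
    rw [Module.End.iSup_maxGenEigenspace_eq_top]
    trivial
  rw [Submodule.mem_iSup_iff_exists_finsupp] at hmem
  obtain ⟨F, hF, hsum⟩ := hmem
  have hP : ∀ μ, ∃ P, (F μ : entire) = expPoly μ P := by
    intro μ
    have h1 := hF μ
    rw [Module.End.maxGenEigenspace, Module.End.genEigenspace_restrict, Submodule.mem_comap,
      ← Module.End.maxGenEigenspace, Module.End.mem_maxGenEigenspace] at h1
    obtain ⟨k, hk⟩ := h1
    exact exists_expPoly_of_pow_eq_zero hk
  choose P hP using hP
  refine ⟨F.support, P, ?_, ?_⟩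
  · intro μ hμ
    apply expPoly_eq_zero (μ := μ)
    rw [← hP, Finsupp.notMem_support_iff.1 hμ]
    rfl
  · intro z
    have h1 : f = ∑ μ ∈ F.support, expPoly μ (P μ) := by
      have := congrArg (Subtype.val) hsum
      rw [Finsupp.sum, AddSubmonoidClass.coe_finsetSum] at this
      rw [← Finset.sum_congr rfl fun μ _ => hP μ]
      exact this.symm
    conv_lhs => rw [h1]
    rw [AddSubmonoidClass.coe_finsetSum, Finset.sum_apply]
    rfl

/-! ### Uniqueness for `p y' = A y` and nonvanishing of the determinant. -/

/-- `y` solves `p y' = A y` away from the zeros of `p`. -/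
def IsPolySolution {n : ℕ} (p : ℂ[X]) (A : Matrix (Fin n) (Fin n) ℂ[X]) (y : ℂ → Fin n → ℂ) :
    Prop :=
  ∀ z, p.eval z ≠ 0 → ∀ i,
    HasDerivAt (fun z => y z i) ((∑ k, (A i k).eval z * y z k) / p.eval z) z

theorem isOpen_eval_ne_zero (p : ℂ[X]) : IsOpen {z | p.eval z ≠ 0} :=
  isOpen_ne_fun p.continuous continuous_const

theorem finite_eval_eq_zero {p : ℂ[X]} (hp : p ≠ 0) : {z | p.eval z = 0}.Finite := by
  refine p.roots.toFinset.finite_toSet.subset fun z hz => ?_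
  simpa [hp] using hz

theorem dense_eval_ne_zero {p : ℂ[X]} (hp : p ≠ 0) : Dense {z | p.eval z ≠ 0} :=
  (finite_eval_eq_zero hp).countable.dense_compl ℂ

theorem isPreconnected_eval_ne_zero {p : ℂ[X]} (hp : p ≠ 0) :
    IsPreconnected {z | p.eval z ≠ 0} :=
  ((finite_eval_eq_zero hp).countable.isConnected_compl_of_one_lt_rank
    (by simp)).isPreconnected

section Uniqueness

variable {n : ℕ} {p : ℂ[X]} {A : Matrix (Fin n) (Fin n) ℂ[X]}

theorem IsPolySolution.analyticOnNhd {y : ℂ → Fin n → ℂ} (hy : IsPolySolution p A y) :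
    AnalyticOnNhd ℂ y {z | p.eval z ≠ 0} := by
  refine DifferentiableOn.analyticOnNhd (fun z hz => ?_) (isOpen_eval_ne_zero p)
  exact (differentiableAt_pi.2 fun i => (hy z hz i).differentiableAt).differentiableWithinAt

/-- A zero of finite order `m + 1` is impossible: put `y = (z - z₀) ^ (m + 1) • g`, cancel `(z - z₀)
^ m`, and let `z → z₀` to get `p(z₀) (m + 1) g(z₀) = 0`. -/
theorem IsPolySolution.eventually_eq_zero {y : ℂ → Fin n → ℂ} (hy : IsPolySolution p A y) {z₀ : ℂ}
    (hz₀ : p.eval z₀ ≠ 0) (h0 : y z₀ = 0) : ∀ᶠ z in 𝓝 z₀, y z = 0 := by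
  by_contra hne
  obtain ⟨m, g, hg, hg0, heq⟩ :=
    (hy.analyticOnNhd z₀ hz₀).exists_eventuallyEq_pow_smul_nonzero_iff.2 hne
  cases m with
  | zero => exact hg0 (by simpa [h0] using heq.self_of_nhds.symm)
  | succ m =>
    apply hg0
    ext i
    have hgi : ∀ i, AnalyticAt ℂ (fun w => g w i) z₀ := fun i =>
      (ContinuousLinearMap.proj (R := ℂ) (φ := fun _ : Fin n => ℂ) i).analyticAt _ |>.comp hg
    have hkey : ∀ᶠ z in 𝓝[≠] z₀, p.eval z * ((m + 1) * g z i + (z - z₀) * deriv (fun z => g z i) z)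
        = (z - z₀) * ∑ k, (A i k).eval z * g z k := by
      filter_upwards [nhdsWithin_le_nhds heq, nhdsWithin_le_nhds (eventually_eventually_nhds.2 heq),
        nhdsWithin_le_nhds (hgi i).eventually_analyticAt, self_mem_nhdsWithin,
        nhdsWithin_le_nhds ((isOpen_eval_ne_zero p).mem_nhds hz₀)] with z h1 h2 h3 h4 h5
      have hz : z - z₀ ≠ 0 := sub_ne_zero.2 h4
      have hpz : p.eval z ≠ 0 := h5
      have h6 := ((hasDerivAt_id z).sub_const z₀).pow (m + 1) |>.mul
        h3.differentiableAt.hasDerivAt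
      have h7 := (hy z h5 i).congr_of_eventuallyEq
        (f₁ := (fun z => (id z - z₀)) ^ (m + 1) * fun z => g z i)
        (h2.mono fun x hx => by simp [hx])
      have h8 := h6.unique h7
      simp only [h1, Pi.smul_apply, smul_eq_mul, id, Pi.pow_apply, Nat.add_sub_cancel,
        mul_one] at h8
      have h9 : ∑ k, (A i k).eval z * ((z - z₀) ^ (m + 1) * g z k)
          = (z - z₀) ^ (m + 1) * ∑ k, (A i k).eval z * g z k := by
        rw [Finset.mul_sum]
        exact Finset.sum_congr rfl fun k _ => by ring
      rw [h9, eq_div_iff hpz] at h8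
      have hzm : (z - z₀) ^ m ≠ 0 := pow_ne_zero _ hz
      apply mul_left_cancel₀ hzm
      push_cast at h8
      linear_combination h8
    have hc : ∀ k, Tendsto (fun z => g z k) (𝓝[≠] z₀) (𝓝 (g z₀ k)) := fun k =>
      (hgi k).continuousAt.tendsto.mono_left nhdsWithin_le_nhds
    have hpc : ∀ q : ℂ[X], Tendsto (fun z => q.eval z) (𝓝[≠] z₀) (𝓝 (q.eval z₀)) := fun q =>
      (q.continuous.tendsto z₀).mono_left nhdsWithin_le_nhds
    have hid : Tendsto (fun z => z - z₀) (𝓝[≠] z₀) (𝓝 0) := by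
      have : Tendsto (fun z => z - z₀) (𝓝 z₀) (𝓝 (z₀ - z₀)) := tendsto_id.sub_const z₀
      rw [sub_self] at this
      exact this.mono_left nhdsWithin_le_nhds
    have hl := (hpc p).mul (((hc i).const_mul ((m : ℂ) + 1)).add (hid.mul
      ((hgi i).deriv.continuousAt.tendsto.mono_left nhdsWithin_le_nhds)))
    have hr := hid.mul (tendsto_finsetSum Finset.univ fun k _ => (hpc (A i k)).mul (hc k))
    have h := tendsto_nhds_unique (hl.congr' hkey) hr
    have hm : (m : ℂ) + 1 ≠ 0 := by exact_mod_cast m.succ_ne_zero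
    simpa [hz₀, hm] using h

theorem IsPolySolution.eq_zero {y : ℂ → Fin n → ℂ} (hy : IsPolySolution p A y) (hp : p ≠ 0) {z₀ : ℂ}
    (hz₀ : p.eval z₀ ≠ 0) (h0 : y z₀ = 0) {z : ℂ} (hz : p.eval z ≠ 0) : y z = 0 :=
  hy.analyticOnNhd.eqOn_zero_of_preconnected_of_eventuallyEq_zero
    (isPreconnected_eval_ne_zero hp) hz₀ (hy.eventually_eq_zero hz₀ h0) hz

/-- A kernel vector `v` of `Y z₀` gives a solution `Y v` vanishing at `z₀`, hence on the whole
connected complement of the roots of `p`, which is a linear relation among the columns. -/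
theorem det_ne_zero_of_linearIndependent {Y : ℂ → Matrix (Fin n) (Fin n) ℂ} (hp : p ≠ 0)
    (hY : ∀ j, IsPolySolution p A fun z i => Y z i j) {Ω : Set ℂ} (hΩ : ∀ z ∈ Ω, p.eval z ≠ 0)
    (hli : LinearIndependent ℂ fun j (z : Ω) (i : Fin n) => Y z i j)
    {z₀ : ℂ} (hz₀ : p.eval z₀ ≠ 0) : (Y z₀).det ≠ 0 := by
  intro hdet
  obtain ⟨v, hv, hv0⟩ := Matrix.exists_mulVec_eq_zero_iff.2 hdet
  apply hv
  have hsol : IsPolySolution p A fun z => (Y z).mulVec v := by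
    intro z hz i
    simp only [Matrix.mulVec, dotProduct]
    refine (HasDerivAt.fun_sum fun j _ => (hY j z hz i).mul_const (v j)).congr_deriv ?_
    simp only [Finset.mul_sum, Finset.sum_div, Finset.sum_mul]
    rw [Finset.sum_comm]
    exact Finset.sum_congr rfl fun k _ => Finset.sum_congr rfl fun j _ => by ring
  rw [Fintype.linearIndependent_iff] at hli
  ext j
  refine hli v ?_ j
  funext z i
  have := congrFun (hsol.eq_zero hp hz₀ hv0 (hΩ z z.2)) i
  rw [Matrix.mulVec, dotProduct] at this
  simp only [Finset.sum_apply, Pi.smul_apply, smul_eq_mul, Pi.zero_apply] at this ⊢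
  exact (Finset.sum_congr rfl fun k _ => mul_comm _ _).trans this

end Uniqueness

/-! ### Clearing poles with powers of `p`. -/

section ClearingPoles

/-- At a root `z` of `p`, `p ^ N` contains `(x - z) ^ N`, so `N` need only exceed the finitely many
local pole bounds. Where such a bound must be positive, the value assigned to `g` at the root is
killed by the zero factor. -/
theorem exists_differentiable_pow_mul {p : ℂ[X]} (hp : p ≠ 0) {g : ℂ → ℂ}
    (hmer : ∀ z, MeromorphicAt g z) (hd : ∀ z, p.eval z ≠ 0 → DifferentiableAt ℂ g z) :
    ∃ N₀ : ℕ, ∀ N ≥ N₀, Differentiable ℂ fun z => p.eval z ^ N * g z := by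
  choose m hm using hmer
  refine ⟨p.roots.toFinset.sup m, fun N hN z => ?_⟩
  by_cases hz : p.eval z = 0
  · have hmN : m z ≤ N := le_trans (Finset.le_sup (f := m) (by simpa [hp] using hz)) hN
    obtain ⟨q, hq⟩ := dvd_iff_isRoot.2 (show IsRoot p z from hz)
    obtain ⟨k, rfl⟩ := Nat.exists_eq_add_of_le hmN
    have h1 : (fun x => p.eval x ^ (m z + k) * g x)
        = fun x => ((x - z) ^ k * q.eval x ^ (m z + k)) * ((x - z) ^ m z • g x) := by
      funext x
      rw [hq]
      simp only [eval_mul, eval_sub, eval_X, eval_C, smul_eq_mul, mul_pow, pow_add]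
      ring
    rw [h1]
    exact DifferentiableAt.mul (by fun_prop) (hm z).differentiableAt
  · exact DifferentiableAt.mul (by fun_prop) (hd z hz)

variable {n : ℕ} {M : ℂ → Matrix (Fin n) (Fin n) ℂ} {z : ℂ}

theorem differentiableAt_det (h : ∀ i j, DifferentiableAt ℂ (fun z => M z i j) z) :
    DifferentiableAt ℂ (fun z => (M z).det) z := by
  simp only [Matrix.det_apply']
  exact DifferentiableAt.fun_sum fun σ _ => (differentiableAt_const _).mul
    (DifferentiableAt.fun_finsetProd fun i _ => h _ _)

theorem meromorphicAt_det (h : ∀ i j, MeromorphicAt (fun z => M z i j) z) :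
    MeromorphicAt (fun z => (M z).det) z := by
  simp only [Matrix.det_apply']
  exact MeromorphicAt.fun_sum fun σ _ => (MeromorphicAt.const _ _).fun_mul
    (MeromorphicAt.fun_prod fun i _ => h _ _)

theorem inv_apply_eq (i j : Fin n) :
    (fun z => (M z)⁻¹ i j) = fun z => (M z).det⁻¹ * ((M z).updateRow j (Pi.single i 1)).det := by
  funext z
  rw [Matrix.inv_def, Ring.inverse_eq_inv', Matrix.smul_apply, Matrix.adjugate_apply, smul_eq_mul]

theorem differentiableAt_inv_apply (h : ∀ i j, DifferentiableAt ℂ (fun z => M z i j) z)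
    (hdet : (M z).det ≠ 0) (i j : Fin n) : DifferentiableAt ℂ (fun z => (M z)⁻¹ i j) z := by
  rw [inv_apply_eq]
  refine ((differentiableAt_det h).inv hdet).mul (differentiableAt_det fun a b => ?_)
  by_cases ha : a = j
  · simp [Matrix.updateRow_apply, ha]
  · simpa [Matrix.updateRow_apply, ha] using h a b

theorem meromorphicAt_inv_apply (h : ∀ i j, MeromorphicAt (fun z => M z i j) z) (i j : Fin n) :
    MeromorphicAt (fun z => (M z)⁻¹ i j) z := by
  rw [inv_apply_eq]
  refine (meromorphicAt_det h).fun_inv.fun_mul (meromorphicAt_det fun a b => ?_)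
  by_cases ha : a = j
  · simp [Matrix.updateRow_apply, ha]
  · simpa [Matrix.updateRow_apply, ha] using h a b

theorem exists_differentiable_pow_mul_of_finite {ι : Type*} [Fintype ι] {p : ℂ[X]} (hp : p ≠ 0)
    {g : ι → ℂ → ℂ} (hmer : ∀ i z, MeromorphicAt (g i) z)
    (hd : ∀ i z, p.eval z ≠ 0 → DifferentiableAt ℂ (g i) z) :
    ∃ N₀ : ℕ, ∀ N ≥ N₀, ∀ i, Differentiable ℂ fun z => p.eval z ^ N * g i z := by
  choose N₀ hN₀ using fun i => exists_differentiable_pow_mul hp (hmer i) (hd i)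
  exact ⟨Finset.univ.sup N₀, fun N hN i =>
    hN₀ i N (le_trans (Finset.le_sup (Finset.mem_univ i)) hN)⟩

end ClearingPoles

/-! ### The differentiation-stable row space and the exponential parts of solutions. -/

section ExponentialPolynomials

variable {n : ℕ} (p : ℂ[X]) (A : Matrix (Fin n) (Fin n) ℂ[X]) (Y : ℂ → Matrix (Fin n) (Fin n) ℂ)

/-- The entire vector functions of the form `p⁻ᴺ wᵀ Y`, where `w` is a vector of polynomials of
degree at most `K`. -/
def rowSpace (N K : ℕ) : Submodule ℂ (Fin n → entire) where
  carrier := {f | ∃ w : Fin n → ℂ[X], (∀ i, w i ∈ degreeLT ℂ (K + 1)) ∧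
    ∀ z, p.eval z ≠ 0 → ∀ j, p.eval z ^ N * (f j : ℂ → ℂ) z = ∑ i, (w i).eval z * Y z i j}
  add_mem' := by
    rintro f g ⟨w, hw, hf⟩ ⟨v, hv, hg⟩
    refine ⟨w + v, fun i => Submodule.add_mem _ (hw i) (hv i), fun z hz j => ?_⟩
    simp only [Pi.add_apply, Submodule.coe_add, mul_add, hf z hz j, hg z hz j, eval_add, add_mul,
      Finset.sum_add_distrib]
  zero_mem' := ⟨0, fun i => Submodule.zero_mem _, fun z hz j => by simp⟩
  smul_mem' := by
    rintro c f ⟨w, hw, hf⟩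
    refine ⟨c • w, fun i => Submodule.smul_mem _ c (hw i), fun z hz j => ?_⟩
    have h1 : p.eval z ^ N * ((c • f) j : ℂ → ℂ) z = c * (p.eval z ^ N * (f j : ℂ → ℂ) z) := by
      simp only [Pi.smul_apply, Submodule.coe_smul, smul_eq_mul]
      ring
    rw [h1, hf z hz j, Finset.mul_sum]
    refine Finset.sum_congr rfl fun i _ => ?_
    simp only [Pi.smul_apply, eval_smul, smul_eq_mul]
    ring

/-- Restriction of entire vector functions to the complement of the zeros of `p`. -/
def restrictNeZero : (Fin n → entire) →ₗ[ℂ] (Fin n → {z // p.eval z ≠ 0} → ℂ) where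
  toFun f j z := (f j : ℂ → ℂ) z
  map_add' _ _ := rfl
  map_smul' _ _ := rfl

/-- The map `w ↦ p⁻ᴺ wᵀ Y` on the complement of the zeros of `p`. -/
noncomputable def rowMap (N K : ℕ) :
    (Fin n → degreeLT ℂ (K + 1)) →ₗ[ℂ] (Fin n → {z // p.eval z ≠ 0} → ℂ) where
  toFun w j z := (∑ i, (w i : ℂ[X]).eval (z : ℂ) * Y z i j) / p.eval (z : ℂ) ^ N
  map_add' w v := by
    funext j z
    simp only [Pi.add_apply, Submodule.coe_add, eval_add, add_mul, Finset.sum_add_distrib, add_div]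
  map_smul' c w := by
    funext j z
    simp only [Pi.smul_apply, Submodule.coe_smul, eval_smul, smul_eq_mul, mul_assoc, RingHom.id_apply,
      ← Finset.mul_sum, mul_div_assoc]

variable {p A Y}

theorem restrictNeZero_injective (hp : p ≠ 0) :
    Function.Injective (restrictNeZero (n := n) p) := by
  intro f g h
  funext j
  ext z
  refine congrFun (Continuous.ext_on (dense_eval_ne_zero hp) (entire_differentiable (f j)).continuous
    (entire_differentiable (g j)).continuous fun z hz => ?_) z
  exact congrFun (congrFun h j) ⟨z, hz⟩

/-- An entire vector is determined off the roots of `p`, and there it is a value of `rowMap`, whose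
domain is finite-dimensional. -/
theorem finiteDimensional_rowSpace (hp : p ≠ 0) (N K : ℕ) :
    FiniteDimensional ℂ (rowSpace p Y N K) := by
  have hfin : FiniteDimensional ℂ (degreeLT ℂ (K + 1)) :=
    (degreeLTEquiv ℂ (K + 1)).symm.finiteDimensional
  have hle : (rowSpace p Y N K).map (restrictNeZero p) ≤ LinearMap.range (rowMap p Y N K) := by
    rintro _ ⟨f, ⟨w, hw, hf⟩, rfl⟩
    refine ⟨fun i => ⟨w i, hw i⟩, ?_⟩
    funext j z
    change (∑ i, (w i).eval (z : ℂ) * Y z i j) / p.eval (z : ℂ) ^ N = (f j : ℂ → ℂ) z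
    rw [← hf z z.2 j, mul_div_cancel_left₀ _ (pow_ne_zero _ z.2)]
  have : FiniteDimensional ℂ ((rowSpace p Y N K).map (restrictNeZero p)) :=
    Submodule.finiteDimensional_of_le hle
  exact (Submodule.equivMapOfInjective _ (restrictNeZero_injective hp)
    (rowSpace p Y N K)).symm.finiteDimensional

/-- The polynomial vector with `p · (p⁻ᴺ wᵀ Y)' = p⁻ᴺ Wᵀ Y`. -/
noncomputable def rowDeriv (p : ℂ[X]) (A : Matrix (Fin n) (Fin n) ℂ[X]) (N : ℕ) (w : Fin n → ℂ[X])
    (i : Fin n) : ℂ[X] :=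
  p * derivative (w i) + ∑ k, w k * A k i - C (N : ℂ) * derivative p * w i

theorem natDegree_rowDeriv_le {N K : ℕ} (hA : ∀ i j, (A i j).natDegree ≤ p.natDegree)
    {w : Fin n → ℂ[X]} (hw : ∀ i, (w i).natDegree ≤ K) (i : Fin n) :
    (rowDeriv p A N w i).natDegree ≤ p.natDegree + K := by
  have hder : ∀ q : ℂ[X], (derivative q).natDegree ≤ q.natDegree := fun q =>
    (natDegree_derivative_le q).trans (Nat.sub_le _ _)
  refine (natDegree_sub_le _ _).trans (max_le (natDegree_add_le_of_degree_le ?_ ?_) ?_)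
  · exact natDegree_mul_le.trans (add_le_add le_rfl ((hder _).trans (hw i)))
  · refine natDegree_sum_le_of_forall_le _ _ fun k _ => ?_
    exact natDegree_mul_le.trans ((add_le_add (hw k) (hA k i)).trans (add_comm _ _).le)
  · rw [mul_assoc]
    exact (natDegree_C_mul_le _ _).trans
      (natDegree_mul_le.trans (add_le_add (hder _) (hw i)))

theorem sum_rowDeriv (hY : ∀ j, IsPolySolution p A fun z i => Y z i j) {N : ℕ}
    {w : Fin n → ℂ[X]} {f : ℂ → ℂ} (hf : Differentiable ℂ f) {j : Fin n}
    (h : ∀ z, p.eval z ≠ 0 → p.eval z ^ N * f z = ∑ i, (w i).eval z * Y z i j)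
    {z : ℂ} (hz : p.eval z ≠ 0) :
    ∑ i, (rowDeriv p A N w i).eval z * Y z i j = p.eval z * (p.eval z ^ N * deriv f z) := by
  have h1 := ((p.hasDerivAt z).fun_pow N).mul (hf z).hasDerivAt
  have h2 := HasDerivAt.fun_sum (u := Finset.univ) fun i _ =>
    ((w i).hasDerivAt z).mul (hY j z hz i)
  have h3 := h1.unique (h2.congr_of_eventuallyEq
    (((isOpen_eval_ne_zero p).eventually_mem hz).mono fun x hx => h x hx))
  have h4 : p.eval z * (N * p.eval z ^ (N - 1)) = N * p.eval z ^ N := by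
    cases N with
    | zero => simp
    | succ N => simp only [Nat.add_sub_cancel]; ring
  have h5 : ∑ i, (rowDeriv p A N w i).eval z * Y z i j
      = p.eval z * (∑ i, ((derivative (w i)).eval z * Y z i j
          + (w i).eval z * ((∑ k, (A i k).eval z * Y z k j) / p.eval z)))
        - N * (derivative p).eval z * ∑ i, (w i).eval z * Y z i j := by
    have h6 : ∑ i, (∑ k, (w k).eval z * (A k i).eval z) * Y z i j
        = ∑ i, (w i).eval z * ∑ k, (A i k).eval z * Y z k j := by
      simp only [Finset.mul_sum, Finset.sum_mul]
      rw [Finset.sum_comm]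
      exact Finset.sum_congr rfl fun k _ => Finset.sum_congr rfl fun j _ => by ring
    have h7 : ∀ i, (rowDeriv p A N w i).eval z * Y z i j
        = p.eval z * ((derivative (w i)).eval z * Y z i j)
          + (∑ k, (w k).eval z * (A k i).eval z) * Y z i j
          - N * (derivative p).eval z * ((w i).eval z * Y z i j) := by
      intro i
      simp only [rowDeriv, eval_sub, eval_add, eval_mul, eval_finsetSum, eval_C]
      ring
    simp only [h7, Finset.sum_sub_distrib, Finset.sum_add_distrib, h6, mul_add, ← Finset.mul_sum]
    congr 2
    rw [Finset.mul_sum]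
    refine Finset.sum_congr rfl fun i _ => ?_
    field_simp
  rw [h5, ← h z hz]
  simp only at h3
  rw [← h3]
  linear_combination (derivative p).eval z * f z * h4

/-- The crux: regularity of `p ^ N * Y⁻¹` forces `p` to divide `rowDeriv`, and `hA` ensures that the
quotient does not exceed degree `K`. -/
theorem derivEnd_mem_rowSpace (hp : p ≠ 0) (hA : ∀ i j, (A i j).natDegree ≤ p.natDegree)
    (hY : ∀ j, IsPolySolution p A fun z i => Y z i j)
    (hdet : ∀ z, p.eval z ≠ 0 → (Y z).det ≠ 0) {N K : ℕ}
    (hinv : ∀ i j, Differentiable ℂ fun z => p.eval z ^ N * (Y z)⁻¹ i j)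
    {f : Fin n → entire} (hf : f ∈ rowSpace p Y N K) :
    (fun j => derivEnd (f j)) ∈ rowSpace p Y N K := by
  obtain ⟨w, hw, hfw⟩ := hf
  have hw' : ∀ i, (w i).natDegree ≤ K := fun i =>
    natDegree_le_iff_degree_le.2 (mem_degreeLE.1 (degreeLT_succ_eq_degreeLE (R := ℂ) ▸ hw i))
  have hsum := fun (z : ℂ) (hz : p.eval z ≠ 0) (j : Fin n) =>
    sum_rowDeriv hY (entire_differentiable (f j)) (fun z hz => hfw z hz j) hz
  have hdvd : ∀ i, p ∣ rowDeriv p A N w i := by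
    intro i
    set g : ℂ → ℂ := fun z => ∑ j, deriv (f j : ℂ → ℂ) z * (p.eval z ^ N * (Y z)⁻¹ j i) with hg
    have hgc : Continuous g := continuous_finsetSum _ fun j _ =>
      (entire_differentiable (derivEnd (f j))).continuous.mul (hinv j i).continuous
    refine dvd_of_eval_eq_mul_continuous p hp _ g hgc ?_
    refine congrFun (Continuous.ext_on (dense_eval_ne_zero hp) (rowDeriv p A N w i).continuous
      (p.continuous.mul hgc) fun z hz => ?_)
    have h1 : Matrix.vecMul (fun i => (rowDeriv p A N w i).eval z) (Y z)
        = fun j => p.eval z * (p.eval z ^ N * deriv (f j : ℂ → ℂ) z) := funext (hsum z hz)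
    have h2 := congrArg (fun v => Matrix.vecMul v (Y z)⁻¹ i) h1
    simp only [Matrix.vecMul_vecMul, Matrix.mul_nonsing_inv _ (hdet z hz).isUnit,
      Matrix.vecMul_one] at h2
    rw [h2, hg, Matrix.vecMul, dotProduct, Finset.mul_sum]
    exact Finset.sum_congr rfl fun j _ => by ring
  choose v hv using hdvd
  refine ⟨v, fun i => ?_, fun z hz j => ?_⟩
  · rw [mem_degreeLT]
    by_cases h0 : v i = 0
    · rw [h0, degree_zero]
      exact WithBot.bot_lt_coe _
    have h1 := natDegree_rowDeriv_le (N := N) hA hw' i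
    rw [hv i, natDegree_mul hp h0] at h1
    rw [degree_eq_natDegree h0]
    exact_mod_cast (by omega : (v i).natDegree < K + 1)
  · have h1 := hsum z hz j
    simp only [hv, eval_mul, mul_assoc, ← Finset.mul_sum] at h1
    exact (mul_left_cancel₀ hz h1).symm

/-- A fundamental matrix which is meromorphic on `ℂ` has entries which are, up to a power of `p`,
exponential polynomials. -/
theorem exists_exponential_polynomials (hp : p ≠ 0)
    (hA : ∀ i j, (A i j).natDegree ≤ p.natDegree)
    (hY : ∀ j, IsPolySolution p A fun z i => Y z i j)
    (hdet : ∀ z, p.eval z ≠ 0 → (Y z).det ≠ 0)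
    (hmer : ∀ i j z, MeromorphicAt (fun z => Y z i j) z) :
    ∃ (N : ℕ) (S : Finset ℂ) (P : ℂ → Matrix (Fin n) (Fin n) ℂ[X]),
      ∀ z i j, p.eval z ^ N * Y z i j = ∑ μ ∈ S, (P μ i j).eval z * Complex.exp (μ * z) := by
  have hYd : ∀ z, p.eval z ≠ 0 → ∀ i j, DifferentiableAt ℂ (fun z => Y z i j) z :=
    fun z hz i j => (hY j z hz i).differentiableAt
  obtain ⟨N₁, hN₁⟩ := exists_differentiable_pow_mul_of_finite (ι := Fin n × Fin n) hp
    (g := fun x z => Y z x.1 x.2) (fun x z => hmer x.1 x.2 z) (fun x z hz => hYd z hz x.1 x.2)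
  obtain ⟨N₂, hN₂⟩ := exists_differentiable_pow_mul_of_finite (ι := Fin n × Fin n) hp
    (g := fun x z => (Y z)⁻¹ x.1 x.2)
    (fun x z => meromorphicAt_inv_apply (fun i j => hmer i j z) x.1 x.2)
    (fun x z hz => differentiableAt_inv_apply (hYd z hz) (hdet z hz) x.1 x.2)
  obtain ⟨N, h1, h2⟩ : ∃ N, N₁ ≤ N ∧ N₂ ≤ N := ⟨max N₁ N₂, le_max_left _ _, le_max_right _ _⟩
  have hfin := finiteDimensional_rowSpace (Y := Y) hp N ((p ^ (2 * N)).natDegree)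
  have key : ∀ i j, ∃ (S : Finset ℂ) (P : ℂ → ℂ[X]), (∀ μ ∉ S, P μ = 0) ∧
      ∀ z, p.eval z ^ N * Y z i j = ∑ μ ∈ S, (P μ).eval z * Complex.exp (μ * z) := by
    intro i j
    set f : Fin n → entire := fun j => ⟨fun z => p.eval z ^ N * Y z i j, hN₁ N h1 (i, j)⟩
    -- One factor `p ^ N` offsets the prefactor `p⁻ᴺ`, the other makes row `i` of `Y` entire; hence
    -- the exponent `2 * N` and the choice of `K`.
    have hf : f ∈ rowSpace p Y N ((p ^ (2 * N)).natDegree) := by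
      refine ⟨Pi.single i (p ^ (2 * N)), fun k => ?_, fun z hz j => ?_⟩
      · by_cases hk : k = i
        · subst hk
          rw [Pi.single_eq_same, mem_degreeLT]
          exact degree_le_natDegree.trans_lt (by exact_mod_cast Nat.lt_succ_self _)
        · rw [Pi.single_eq_of_ne hk]
          exact Submodule.zero_mem _
      · rw [Finset.sum_eq_single i (fun k _ hk => by simp [Pi.single_eq_of_ne hk]) (by simp)]
        change p.eval z ^ N * (p.eval z ^ N * Y z i j) = _
        rw [Pi.single_eq_same, eval_pow]
        ring
    have hfin' : FiniteDimensional ℂ ((rowSpace p Y N ((p ^ (2 * N)).natDegree)).map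
        (LinearMap.proj (R := ℂ) (φ := fun _ : Fin n => entire) j)) := inferInstance
    refine exists_sum_expPoly ((rowSpace p Y N ((p ^ (2 * N)).natDegree)).map
      (LinearMap.proj (R := ℂ) (φ := fun _ : Fin n => entire) j)) ?_ (f j) ⟨f, hf, rfl⟩
    rintro _ ⟨g, hg, rfl⟩
    exact ⟨_, derivEnd_mem_rowSpace hp hA hY hdet (fun i j => hN₂ N h2 (i, j)) hg, rfl⟩
  choose S P hP0 hP using key
  classical
  refine ⟨N, Finset.univ.biUnion fun x : Fin n × Fin n => S x.1 x.2, fun μ i j => P i j μ, ?_⟩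
  intro z i j
  rw [hP i j z]
  refine Finset.sum_subset (fun μ hμ => Finset.mem_biUnion.2 ⟨(i, j), Finset.mem_univ _, hμ⟩)
    fun μ _ hμ => ?_
  rw [hP0 i j μ hμ, eval_zero, zero_mul]

/-- Each exponential part of an exponential-polynomial solution matrix is a solution matrix. -/
theorem isPolySolution_expPoly (hp : p ≠ 0) (hY : ∀ j, IsPolySolution p A fun z i => Y z i j)
    {N : ℕ} {S : Finset ℂ} {P : ℂ → Matrix (Fin n) (Fin n) ℂ[X]}
    (h : ∀ z i j, p.eval z ^ N * Y z i j = ∑ μ ∈ S, (P μ i j).eval z * Complex.exp (μ * z))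
    {μ : ℂ} (hμ : μ ∈ S) (j : Fin n) :
    IsPolySolution p A fun z i => (P μ i j).eval z / p.eval z ^ N * Complex.exp (μ * z) := by
  -- The equation `p (p ^ N Y)' = N p' p ^ N Y + A p ^ N Y` becomes a vanishing exponential
  -- polynomial, so the coefficient of each exponential vanishes separately.
  have hid : ∀ i, p * (derivative (P μ i j) + C μ * P μ i j)
      - (C (N : ℂ) * derivative p * P μ i j + ∑ k, A i k * P μ k j) = 0 := by
    intro i
    refine eq_zero_of_sum_expPoly_eq_zero S (fun μ => p * (derivative (P μ i j) + C μ * P μ i j)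
      - (C (N : ℂ) * derivative p * P μ i j + ∑ k, A i k * P μ k j)) ?_ μ hμ
    refine congrFun (Continuous.ext_on (dense_eval_ne_zero hp) ?_ continuous_const fun z hz => ?_)
    · exact continuous_finsetSum _ fun μ _ => (Polynomial.continuous _).mul (by fun_prop)
    have h1 := ((p.hasDerivAt z).fun_pow N).mul (hY j z hz i)
    have h2 := HasDerivAt.fun_sum (u := S) fun μ _ => hasDerivAt_expPoly μ (P μ i j) z
    have h3 := h1.unique (h2.congr_of_eventuallyEq (Eventually.of_forall fun x => h x i j))
    have h4 : p.eval z * (N * p.eval z ^ (N - 1)) = N * p.eval z ^ N := by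
      cases N with
      | zero => simp
      | succ N => simp only [Nat.add_sub_cancel]; ring
    have h5 : ∑ μ ∈ S, (p * (derivative (P μ i j) + C μ * P μ i j)
          - (C (N : ℂ) * derivative p * P μ i j + ∑ k, A i k * P μ k j)).eval z * Complex.exp (μ * z)
        = p.eval z * (∑ μ ∈ S, (derivative (P μ i j) + C μ * P μ i j).eval z * Complex.exp (μ * z))
          - (N * (derivative p).eval z * ∑ μ ∈ S, (P μ i j).eval z * Complex.exp (μ * z)
            + ∑ k, (A i k).eval z * ∑ μ ∈ S, (P μ k j).eval z * Complex.exp (μ * z)) := by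
      have h6 : ∑ k, (A i k).eval z * ∑ μ ∈ S, (P μ k j).eval z * Complex.exp (μ * z)
          = ∑ μ ∈ S, (∑ k, (A i k).eval z * (P μ k j).eval z) * Complex.exp (μ * z) := by
        simp only [Finset.mul_sum, Finset.sum_mul]
        rw [Finset.sum_comm]
        exact Finset.sum_congr rfl fun k _ => Finset.sum_congr rfl fun j _ => by ring
      rw [h6, Finset.mul_sum, Finset.mul_sum, ← Finset.sum_add_distrib, ← Finset.sum_sub_distrib]
      refine Finset.sum_congr rfl fun μ _ => ?_
      simp only [eval_sub, eval_add, eval_mul, eval_finsetSum, eval_C]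
      ring
    have h7 : ∑ k, (A i k).eval z * (p.eval z ^ N * Y z k j)
        = p.eval z ^ N * ∑ k, (A i k).eval z * Y z k j := by
      rw [Finset.mul_sum]
      exact Finset.sum_congr rfl fun k _ => by ring
    simp only at h3 ⊢
    simp only [h5, ← h3, ← h, h7]
    have hz' : p.eval z ≠ 0 := hz
    have h8 : p.eval z * ((∑ k, (A i k).eval z * Y z k j) / p.eval z)
        = ∑ k, (A i k).eval z * Y z k j := mul_div_cancel₀ _ hz'
    linear_combination (derivative p).eval z * Y z i j * h4 + p.eval z ^ N * h8
  intro z hz i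
  have h1 := ((hasDerivAt_expPoly μ (P μ i j) z).div ((p.hasDerivAt z).fun_pow N)
    (pow_ne_zero N hz))
  have h2 := congrArg (eval z) (hid i)
  simp only [eval_sub, eval_add, eval_mul, eval_finsetSum, eval_C, eval_zero] at h2
  refine (h1.congr_of_eventuallyEq (Eventually.of_forall fun x => ?_)).congr_deriv ?_
  · simp only [Pi.div_apply]
    ring
  have h3 : ∑ k, (A i k).eval z * ((P μ k j).eval z / p.eval z ^ N * Complex.exp (μ * z))
      = (∑ k, (A i k).eval z * (P μ k j).eval z) * (Complex.exp (μ * z) / p.eval z ^ N) := by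
    rw [Finset.sum_mul]
    exact Finset.sum_congr rfl fun k _ => by ring
  rw [h3, ← sub_eq_zero.1 (by linear_combination -h2 : (∑ k, (A i k).eval z * (P μ k j).eval z) -
    (p.eval z * ((derivative (P μ i j)).eval z + μ * (P μ i j).eval z)
      - N * (derivative p).eval z * (P μ i j).eval z) = 0) |>.symm]
  simp only [eval_add, eval_mul, eval_C]
  cases N with
  | zero => field_simp; simp
  | succ N =>
    simp only [Nat.add_sub_cancel]
    field_simp
    ring

end ExponentialPolynomials

/-! ### Selecting columns, identifying exponents, and assembling the result. -/

/-- Equal multiplicities mean that fibres over each value have equal size; bijections of fibres glue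
to a permutation. -/
theorem exists_perm_of_map_univ_eq {α : Type*} {n : ℕ} {f g : Fin n → α}
    (h : Multiset.map f Finset.univ.val = Multiset.map g Finset.univ.val) :
    ∃ σ : Equiv.Perm (Fin n), ∀ i, f i = g (σ i) := by
  classical
  have hcard : ∀ c, Fintype.card {i // f i = c} = Fintype.card {i // g i = c} := by
    intro c
    have h1 := congrArg (Multiset.count c) h
    rw [Multiset.count_map, Multiset.count_map] at h1
    rw [Fintype.card_subtype, Fintype.card_subtype, Finset.card_def, Finset.card_def,
      Finset.filter_val, Finset.filter_val]
    simpa only [eq_comm] using h1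
  exact ⟨Equiv.ofFiberEquiv fun c => Fintype.equivOfCardEq (hcard c), fun i =>
    (Equiv.ofFiberEquiv_map _ i).symm⟩

/-- A spanning finite family contains as many independent members as any independent family. -/
theorem exists_linearIndependent_comp {V ι : Type*} [AddCommGroup V] [Module ℂ V] [Finite ι]
    {n : ℕ} {y : Fin n → V} (hy : LinearIndependent ℂ y) (s : ι → V)
    (hspan : ∀ j, y j ∈ Submodule.span ℂ (Set.range s)) :
    ∃ e : Fin n → ι, LinearIndependent ℂ (s ∘ e) := by
  obtain ⟨κ, a, ha, hsp, hli⟩ := exists_linearIndependent' ℂ s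
  have : Finite κ := Finite.of_injective a ha
  have := Fintype.ofFinite κ
  have := Fintype.ofFinite (Set.range (s ∘ a))
  have h1 := linearIndependent_le_span' y hy (Set.range (s ∘ a))
    (by rintro _ ⟨j, rfl⟩; rw [SetLike.mem_coe, hsp]; exact hspan j)
  have h2 : Fintype.card (Fin n) ≤ Fintype.card κ := by
    refine le_trans (by simpa using h1) (Fintype.card_range_le (s ∘ a))
  obtain ⟨e⟩ := Function.Embedding.nonempty_of_card_le h2
  exact ⟨a ∘ e, hli.comp e e.injective⟩

variable {n : ℕ}

theorem isSolution_iff {Q : Matrix (Fin n) (Fin n) (RatFunc ℂ)} {p : ℂ[X]}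
    {A : Matrix (Fin n) (Fin n) ℂ[X]} (hreg : ∀ z, z ∈ regularSet Q ↔ p.eval z ≠ 0)
    (hQ : ∀ z ∈ regularSet Q, ∀ i j, matEval Q z i j = (A i j).eval z / p.eval z)
    (y : ℂ → Fin n → ℂ) : IsSolution Q y ↔ IsPolySolution p A y := by
  simp only [IsSolution, IsPolySolution, hasDerivAt_pi]
  refine forall_congr' fun z => ?_
  rw [hreg]
  refine forall_congr' fun hz => forall_congr' fun i => ?_
  have : Matrix.mulVec (matEval Q z) (y z) i = (∑ k, (A i k).eval z * y z k) / p.eval z := by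
    rw [Matrix.mulVec, dotProduct, Finset.sum_div]
    refine Finset.sum_congr rfl fun k _ => ?_
    rw [hQ z ((hreg z).2 hz)]
    ring
  rw [this]

theorem IsPolySolution.congr {p : ℂ[X]} {A : Matrix (Fin n) (Fin n) ℂ[X]} {y u : ℂ → Fin n → ℂ}
    (hy : IsPolySolution p A y) (h : ∀ z, p.eval z ≠ 0 → u z = y z) : IsPolySolution p A u := by
  intro z hz i
  rw [h z hz]
  exact (hy z hz i).congr_of_eventuallyEq
    (((isOpen_eval_ne_zero p).eventually_mem hz).mono fun x hx => congrFun (h x hx) i)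

theorem tendsto_valueAtInfinity {Q : Matrix (Fin n) (Fin n) (RatFunc ℂ)} {p : ℂ[X]} (hp : p ≠ 0)
    {A : Matrix (Fin n) (Fin n) ℂ[X]} (hreg : ∀ z, z ∈ regularSet Q ↔ p.eval z ≠ 0)
    (hQ : ∀ z ∈ regularSet Q, ∀ i j, matEval Q z i j = (A i j).eval z / p.eval z)
    (hA : ∀ i j, (A i j).natDegree ≤ p.natDegree) (i j : Fin n) :
    Tendsto (fun z => (A i j).eval z / p.eval z) (Bornology.cobounded ℂ)
      (𝓝 (valueAtInfinity Q i j)) := by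
  obtain ⟨c, hc⟩ := tendsto_eval_div hp (hA i j)
  have h1 : Tendsto (fun z => ratEval (Q i j) z) (Bornology.cobounded ℂ) (𝓝 c) := by
    refine hc.congr' ?_
    filter_upwards [eventually_eval_ne_zero hp] with z hz
    exact (hQ z ((hreg z).2 hz) i j).symm
  -- `limUnder` is meaningful only because convergence was just obtained from the degree bound.
  have h2 : valueAtInfinity Q i j = c := h1.limUnder_eq
  rwa [h2]

theorem meromorphicAt_eval_inv (B : ℂ[X]) (x : ℂ) : MeromorphicAt (fun w => B.eval w⁻¹) x := by
  simp only [eval_eq_sum_range]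
  exact MeromorphicAt.fun_sum fun k _ => (MeromorphicAt.const _ _).fun_mul
    ((MeromorphicAt.id x).fun_inv.fun_pow k)

/-- The exponents of a fundamental matrix `B p⁻ᴺ exp (diag μ z)` of `p y' = A y` are the
eigenvalues of `A / p` at infinity. -/
theorem charpoly_eq_prod_of_isPolySolution {p : ℂ[X]} (hp : p ≠ 0)
    {A B : Matrix (Fin n) (Fin n) ℂ[X]} {N : ℕ} {μ : Fin n → ℂ}
    (hsol : ∀ j, IsPolySolution p A fun z i =>
      (B i j).eval z / p.eval z ^ N * Complex.exp (μ j * z))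
    (hdet : ∀ z, p.eval z ≠ 0 → (Matrix.of fun i j =>
      (B i j).eval z / p.eval z ^ N * Complex.exp (μ j * z)).det ≠ 0)
    {Q₀ : Matrix (Fin n) (Fin n) ℂ}
    (hQ₀ : ∀ i j, Tendsto (fun z => (A i j).eval z / p.eval z) (Bornology.cobounded ℂ)
      (𝓝 (Q₀ i j))) :
    Q₀.charpoly = ∏ j, (X - C (μ j)) := by
  have hinv : Tendsto (fun w : ℂ => w⁻¹) (𝓝[≠] 0) (Bornology.cobounded ℂ) :=
    tendsto_inv₀_nhdsNE_zero
  refine charpoly_eq_prod_of_meromorphicAt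
    (fun w => Matrix.of fun i j => (B i j).eval w⁻¹ / p.eval w⁻¹ ^ N)
    (fun w => Matrix.of fun i j => (A i j).eval w⁻¹ / p.eval w⁻¹) ?_ Q₀
    (fun i j => (hQ₀ i j).comp hinv) μ ?_ ?_
  · intro i j
    exact (meromorphicAt_eval_inv _ _).fun_div ((meromorphicAt_eval_inv _ _).fun_pow N)
  · filter_upwards [hinv.eventually (eventually_eval_ne_zero hp), self_mem_nhdsWithin]
      with w hpw hw i j
    have hw : w ≠ 0 := hw
    have h1 : HasDerivAt (fun z => Complex.exp (-μ j * z))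
        (Complex.exp (-μ j * w⁻¹) * (-μ j * 1)) w⁻¹ :=
      ((hasDerivAt_id w⁻¹).const_mul (-μ j)).cexp
    have hexp : ∀ z, Complex.exp (μ j * z) * Complex.exp (-μ j * z) = 1 := fun z => by
      rw [← Complex.exp_add]; simp
    -- Multiplying the solution by `e^{-μz}` isolates the rational factor; composing with `w⁻¹`
    -- below supplies the `-1 / w ^ 2`.
    have h2 : HasDerivAt (fun z => (B i j).eval z / p.eval z ^ N) _ w⁻¹ :=
      ((hsol j w⁻¹ hpw i).mul h1).congr_of_eventuallyEq (Eventually.of_forall fun x => by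
        simp only [Pi.mul_apply]
        rw [mul_assoc, hexp, mul_one])
    refine (h2.comp w (hasDerivAt_inv hw)).congr_deriv ?_
    have h3 : (∑ k, (A i k).eval w⁻¹ * ((B k j).eval w⁻¹ / p.eval w⁻¹ ^ N *
          Complex.exp (μ j * w⁻¹))) / p.eval w⁻¹
        = (∑ k, (A i k).eval w⁻¹ / p.eval w⁻¹ * ((B k j).eval w⁻¹ / p.eval w⁻¹ ^ N))
          * Complex.exp (μ j * w⁻¹) := by
      rw [Finset.sum_div, Finset.sum_mul]
      exact Finset.sum_congr rfl fun k _ => by ring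
    simp only [Matrix.mul_apply, Matrix.of_apply, h3]
    rw [div_eq_mul_inv _ (w ^ 2)]
    linear_combination (-(w ^ 2)⁻¹) *
      ((∑ k, (A i k).eval w⁻¹ / p.eval w⁻¹ * ((B k j).eval w⁻¹ / p.eval w⁻¹ ^ N))
        - μ j * ((B i j).eval w⁻¹ / p.eval w⁻¹ ^ N)) * hexp w⁻¹
  · filter_upwards [hinv.eventually (eventually_eval_ne_zero hp)] with w hpw h0
    apply hdet w⁻¹ hpw
    have : (Matrix.of fun i j => (B i j).eval w⁻¹ / p.eval w⁻¹ ^ N * Complex.exp (μ j * w⁻¹))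
        = (Matrix.of fun i j => (B i j).eval w⁻¹ / p.eval w⁻¹ ^ N) *
          Matrix.diagonal fun j => Complex.exp (μ j * w⁻¹) := by
      ext i j
      simp [Matrix.mul_diagonal]
    rw [this, Matrix.det_mul, h0, zero_mul]

/-- A meromorphic fundamental system can be replaced by one consisting of products of rational
functions with exponentials. -/
theorem exists_rational_exponential_system {p : ℂ[X]} (hp : p ≠ 0)
    {A : Matrix (Fin n) (Fin n) ℂ[X]} (hA : ∀ i j, (A i j).natDegree ≤ p.natDegree)
    {Ω : Set ℂ} (hΩ : ∀ z ∈ Ω, p.eval z ≠ 0) {y : Fin n → ℂ → Fin n → ℂ}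
    (hy : ∀ j, IsPolySolution p A (y j)) (hli : LinearIndependent ℂ fun j (z : Ω) => y j z)
    (hmer : ∀ j, Meromorphic (y j)) :
    ∃ (N : ℕ) (B : Matrix (Fin n) (Fin n) ℂ[X]) (μ : Fin n → ℂ),
      (∀ j, IsPolySolution p A fun z i =>
        (B i j).eval z / p.eval z ^ N * Complex.exp (μ j * z)) ∧
      LinearIndependent ℂ fun j (z : Ω) (i : Fin n) =>
        (B i j).eval (z : ℂ) / p.eval (z : ℂ) ^ N * Complex.exp (μ j * z) := by
  set Y : ℂ → Matrix (Fin n) (Fin n) ℂ := fun z => Matrix.of fun i j => y j z i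
  have hY : ∀ j, IsPolySolution p A fun z i => Y z i j := hy
  have hdet : ∀ z, p.eval z ≠ 0 → (Y z).det ≠ 0 := fun z hz =>
    det_ne_zero_of_linearIndependent hp hY hΩ hli hz
  obtain ⟨N, S, P, hP⟩ := exists_exponential_polynomials hp hA hY hdet
    (fun i j z => meromorphicAt_apply (hmer j z) i)
  set s : S × Fin n → Ω → Fin n → ℂ := fun x z i =>
    (P x.1 i x.2).eval (z : ℂ) / p.eval (z : ℂ) ^ N * Complex.exp (x.1 * z) with hs
  obtain ⟨e, he⟩ := exists_linearIndependent_comp hli s (by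
    intro j
    -- Each original solution is the sum of its exponential parts, so the parts span.
    have : (fun z : Ω => y j z) = ∑ μ : S, s (μ, j) := by
      funext z i
      have h1 := hP z i j
      rw [← Finset.sum_coe_sort] at h1
      simp only [Finset.sum_apply, hs]
      have h2 : p.eval (z : ℂ) ^ N ≠ 0 := pow_ne_zero _ (hΩ z z.2)
      apply mul_left_cancel₀ h2
      rw [Finset.mul_sum]
      refine h1.trans (Finset.sum_congr rfl fun μ _ => ?_)
      field_simp
    rw [this]
    exact Submodule.sum_mem _ fun μ _ => Submodule.subset_span ⟨_, rfl⟩)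
  exact ⟨N, fun i j => P (e j).1 i (e j).2, fun j => (e j).1, fun j =>
    isPolySolution_expPoly hp hY hP (e j).1.2 (e j).2, he⟩

theorem exp_diagonal_mul (M : Matrix (Fin n) (Fin n) ℂ) (v : Fin n → ℂ) (i j : Fin n) :
    (M * NormedSpace.exp (Matrix.diagonal v)) i j = M i j * Complex.exp (v j) := by
  rw [Matrix.exp_diagonal, Matrix.mul_diagonal, Pi.coe_exp, Complex.exp_eq_exp_ℂ]

end Halphen

theorem theorem2p5 (n : ℕ) (Q : Matrix (Fin n) (Fin n) (RatFunc ℂ))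
    (hQ : Halphen.BoundedAtInfinity Q)
    (hmero : Halphen.HasMeromorphicFundamentalSystem Q) :
    (∃ ev : Fin n → ℂ, Halphen.IsEigenvalueList (Halphen.valueAtInfinity Q) ev) ∧
    ∀ ev : Fin n → ℂ, Halphen.IsEigenvalueList (Halphen.valueAtInfinity Q) ev →
      ∃ R : Matrix (Fin n) (Fin n) (RatFunc ℂ),
        Halphen.IsFundamentalMatrix Q fun z =>
          Halphen.matEval R z * NormedSpace.exp (Matrix.diagonal fun j => ev j * z) := by
  open Halphen Polynomial in
  obtain ⟨p, A, hp, hreg, hQA⟩ := exists_common_denominator Q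
  have hA : ∀ i j, (A i j).natDegree ≤ p.natDegree := fun i j => by
    refine natDegree_le_of_isBigO hp ((hQ i j).congr' ?_ Filter.EventuallyEq.rfl)
    filter_upwards [eventually_eval_ne_zero hp] with z hz
    exact hQA z ((hreg z).2 hz) i j
  obtain ⟨y, ⟨hy, hli⟩, hmer⟩ := hmero
  have hΩ : ∀ z ∈ regularSet Q, p.eval z ≠ 0 := fun z => (hreg z).1
  obtain ⟨N, B, μ, hsol, hB⟩ := exists_rational_exponential_system hp hA hΩ
    (fun j => (isSolution_iff hreg hQA _).1 (hy j)) hli hmer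
  have hchar : (valueAtInfinity Q).charpoly = ∏ j, (X - C (μ j)) :=
    charpoly_eq_prod_of_isPolySolution hp hsol
      (fun z hz => det_ne_zero_of_linearIndependent hp hsol hΩ hB hz)
      (tendsto_valueAtInfinity hp hreg hQA hA)
  have hroots : IsEigenvalueList (valueAtInfinity Q) μ := by
    rw [IsEigenvalueList, hchar, Finset.prod, ← roots_multiset_prod_X_sub_C
      (Multiset.map μ Finset.univ.val), Multiset.map_map]
    rfl
  refine ⟨⟨μ, hroots⟩, fun ev hev => ?_⟩
  obtain ⟨σ, hσ⟩ := exists_perm_of_map_univ_eq (hev.symm.trans hroots)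
  -- Columns are permuted by `σ` so that the exponent `μ (σ j)` of column `j` is the prescribed `ev
  -- j`.
  refine ⟨fun i j => algebraMap ℂ[X] (RatFunc ℂ) (B i (σ j)) / algebraMap ℂ[X] (RatFunc ℂ) (p ^ N),
    ?_⟩
  have hval : ∀ z, p.eval z ≠ 0 → ∀ i j, (matEval (fun i j => algebraMap ℂ[X] (RatFunc ℂ)
      (B i (σ j)) / algebraMap ℂ[X] (RatFunc ℂ) (p ^ N)) z *
        NormedSpace.exp (Matrix.diagonal fun j => ev j * z)) i j
      = (B i (σ j)).eval z / p.eval z ^ N * Complex.exp (μ (σ j) * z) := by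
    intro z hz i j
    rw [exp_diagonal_mul]
    change ratEval _ z * _ = _
    rw [ratEval_div _ _ (by rw [eval_pow]; exact pow_ne_zero _ hz), eval_pow, hσ]
  constructor
  · intro j
    rw [isSolution_iff hreg hQA]
    exact (hsol (σ j)).congr fun z hz => funext fun i => hval z hz i j
  · have h1 := hB.comp σ σ.injective
    convert h1 using 1
    funext j z i
    exact hval z (hΩ z z.2) i j
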